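/- Let $X$ be a subset of a normed vector space, let $H$ be a real normed vector space, and let $X^*$ be the set of nonempty finite subsets of $X$. Let $f:X^*\to H$ be a function (an aggregation rule), and write $f(x)$ for $f(\{x\})$. Assume: (a) (strong richness) for every $x\in X$ there are $y,z\in X$ such that $f(x),f(y),f(z)$ are not collinear, $f(\{x,y\})\notin\{f(x),f(y)\}$ and $f(\{x,z\})\notin\{f(x),f(z)\}$; (b) (continuity) for every finite (possibly empty) $A\subset X$, every $x\in X\setminus A$ and every sequence $(x_n)$ in $X$ with $x_n\to x$, one has $f(A\cup\{x_n\})\to f(A\cup\{x\})$; (c) (weighted averaging) for all disjoint $A,B\in X^*$ there is $\lambda\in[0,1]$ with $f(A\cup B)=\lambda f(A)+(1-\lambda)f(B)$. Then there are a weak order $\succcurlyeq$ on $X$ (a reflexive, transitive, complete relation) and a continuous function $w:X\to(0,\infty)$ such that for every $A\in X^*$ $$f(A)=\sum_{x\in M(A,\succcurlyeq)}\frac{w(x)}{\sum_{y\in M(A,\succcurlyeq)}w(y)}\,f(x),\qquad M(A,\succcurlyeq)=\{x\in A:\ x\succcurlyeq y\text{ for all }y\in A\},$$ and $\succcurlyeq$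 is the only weak order for which such a representation exists with some (not necessarily continuous) weight function $X\to(0,\infty)$. Moreover, for every $x\in X$ there is $\varepsilon>0$ such that every $y\in X$ with $\|y-x\|<\varepsilon$ satisfies $y\sim x$, that is, $y\succcurlyeq x$ and $x\succcurlyeq y$. -/

import Mathlib

open Filter Topology

noncomputable section

namespace Aggregation

/-! An aggregation rule on `X` with values in `H` is represented by a function
`f : Finset X → H`; every notion below refers to `f` on nonempty finite sets only, so that the
value of `f` at `∅` plays no role. -/

variable {X H : Type*}

open Classical in
/-- `f (A ∪ B)` lies on the segment between `f A` and `f B` for disjoint nonempty `A`, `B`. -/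
def WeightedAveraging [AddCommGroup H] [Module ℝ H] (f : Finset X → H) : Prop :=
  ∀ A B : Finset X, A.Nonempty → B.Nonempty → Disjoint A B →
    ∃ t : ℝ, 0 ≤ t ∧ t ≤ 1 ∧ f (A ∪ B) = t • f A + (1 - t) • f B

open Classical in
/-- Every `x` has companions `y`, `z` such that the outcomes of `x`, `y`, `z` are not on one line
and the pairs `{x, y}`, `{x, z}` are not aggregated to one of their endpoints. -/
def StronglyRich [AddCommGroup H] [Module ℝ H] (f : Finset X → H) : Prop :=
  ∀ x : X, ∃ y z : X,
    ¬ Collinear ℝ ({f {x}, f {y}, f {z}} : Set H) ∧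
    (f {x, y} ≠ f {x} ∧ f {x, y} ≠ f {y}) ∧
    (f {x, z} ≠ f {x} ∧ f {x, z} ≠ f {z})

open Classical in
/-- Sequential continuity in each single element of a finite set; `A = ∅` is allowed. -/
def ContinuousRule [TopologicalSpace X] [TopologicalSpace H] (f : Finset X → H) : Prop :=
  ∀ (A : Finset X) (x : X), x ∉ A → ∀ u : ℕ → X, Tendsto u atTop (𝓝 x) →
    Tendsto (fun n => f (A ∪ {u n})) atTop (𝓝 (f (A ∪ {x})))

/-- A weak order: reflexive, transitive and complete; `r x y` reads `x ≽ y`. -/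
structure IsWeakOrder (r : X → X → Prop) : Prop where
  refl : ∀ x, r x x
  trans : ∀ x y z, r x y → r y z → r x z
  complete : ∀ x y, r x y ∨ r y x

/-- `x ∼ y`. -/
def Equivalent (r : X → X → Prop) (x y : X) : Prop := r x y ∧ r y x

open Classical in
/-- `M(A, ≽)`: the highest ranked elements of `A`. -/
def highest (A : Finset X) (r : X → X → Prop) : Finset X :=
  A.filter (fun x => ∀ y ∈ A, r x y)

/-- The outcome of each nonempty finite `A` is the `w`-weighted average of the outcomes of the
highest ranked elements of `A`. -/
def Represents [AddCommGroup H] [Module ℝ H]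
    (f : Finset X → H) (r : X → X → Prop) (w : X → ℝ) : Prop :=
  ∀ A : Finset X, A.Nonempty →
    f A = ∑ x ∈ highest A r, (w x / ∑ y ∈ highest A r, w y) • f {x}

end Aggregation

end

/-!
The order and the weights are read off the outcomes of pairs. If `f {x} ≠ f {y}`, then `x` counts
as at least as good as `y` when `f {x, y} ≠ f {y}`; if both points contribute to `f {x, y}` (they
are *tied*), the position of `f {x, y}` on the segment gives the ratio `odds f x y` of their
weights. If the three outcomes of a triple form a nondegenerate triangle, its outcome lies on the
three cevians through the outcomes of the pairs, and uniqueness of barycentric coordinates yields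
transitivity of the comparison (`WeaklyAbove.trans_of_not_collinear`) and multiplicativity of the
odds (`odds_mul_of_not_collinear`). Strong richness supplies, for every `x` and every line through
`f {x}`, an element tied with `x` whose outcome is off that line
(`StronglyRich.exists_tied_off_line`). Passing through such elements removes the restriction to
nondegenerate triples, and makes it possible to compare elements with equal outcomes. The result is
a weak order `Revealed f` and a positive function `weight f` with
`weight f x = odds f x y * weight f y` for tied `x` and `y`.

That `f A` is the weighted average `topAverage f A` of the highest ranked outcomes is proved by
induction on the size of `A`. The averages satisfy the same averaging property as `f`, with
coefficients governed by Luce's choice axiom (`share_eq_sum_mul`). So if `f A ≠ topAverage f A`,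
every splitting of `A` into two smaller sets takes place on the line through these two points. One
adjoins an element off this line and compares splittings of the larger set; see
`eq_topAverage_of_lt`.

An element tied with `x` remains tied with all points near `x`. Hence the classes of the order are
open, and near `x` the weight is a multiple of the odds with respect to a fixed element, which are
continuous. Uniqueness of the order holds because any representation forces the comparison of
pairs with different outcomes, and thereby that of all pairs.
-/

namespace Aggregation

open Classical

variable {X H : Type*}

section Affine

variable [AddCommGroup H] [Module ℝ H]

/-! ### Affine geometry of three points -/

theorem eq_zero_of_not_collinear {a b c : H} (h : ¬ Collinear ℝ ({a, b, c} : Set H))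
    {α β γ : ℝ} (hs : α + β + γ = 0) (hc : α • a + β • b + γ • c = 0) :
    α = 0 ∧ β = 0 ∧ γ = 0 := by
  rw [← affineIndependent_iff_not_collinear_set, affineIndependent_iff] at h
  have := h Finset.univ ![α, β, γ] (by simpa [Fin.sum_univ_three] using hs)
    (by simpa [Fin.sum_univ_three] using hc)
  exact ⟨this 0 (by simp), this 1 (by simp), this 2 (by simp)⟩

/-- Barycentric coordinates with respect to a nondegenerate triangle are unique. -/
theorem coord_eq_of_not_collinear {a b c : H} (h : ¬ Collinear ℝ ({a, b, c} : Set H))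
    {α β γ α' β' γ' : ℝ} (hs : α + β + γ = α' + β' + γ')
    (hc : α • a + β • b + γ • c = α' • a + β' • b + γ' • c) :
    α = α' ∧ β = β' ∧ γ = γ' := by
  have := eq_zero_of_not_collinear h (α := α - α') (β := β - β') (γ := γ - γ') (by linarith)
    (by linear_combination (norm := module) hc)
  refine ⟨?_, ?_, ?_⟩ <;> linarith [this.1, this.2.1, this.2.2]

theorem not_collinear_rotate {a b c : H} (h : ¬ Collinear ℝ ({a, b, c} : Set H)) :
    ¬ Collinear ℝ ({b, c, a} : Set H) := by
  rwa [show ({b, c, a} : Set H) = {a, b, c} by ext; simp; tauto]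

/-- Two distinct points of the line `p + ℝ d` and a point off it are not collinear. -/
theorem not_collinear_of_notMem_line {p d a b c : H} (ha : ∃ α : ℝ, a = p + α • d)
    (hb : ∃ β : ℝ, b = p + β • d) (hab : a ≠ b) (hc : ∀ γ : ℝ, c ≠ p + γ • d) :
    ¬ Collinear ℝ ({a, b, c} : Set H) := by
  intro h
  obtain ⟨α, rfl⟩ := ha
  obtain ⟨β, rfl⟩ := hb
  obtain ⟨v, hv⟩ := (collinear_iff_of_mem (p₀ := p + α • d) (by simp)).1 h
  obtain ⟨r, hr⟩ := hv (p + β • d) (by simp)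
  obtain ⟨t, ht⟩ := hv c (by simp)
  rw [vadd_eq_add] at hr ht
  have hr0 : r ≠ 0 := by
    rintro rfl
    exact hab (by simpa using hr.symm)
  have hvd : v = ((β - α) / r) • d := by
    rw [div_eq_inv_mul, mul_smul, eq_inv_smul_iff₀ hr0]
    linear_combination (norm := module) -hr
  refine hc (α + t * ((β - α) / r)) ?_
  rw [ht, hvd]
  module

end Affine

/-! ### The revealed order -/

section Revealed

variable {f : Finset X → H}

/-- `x` and `y` have different outcomes and `x` contributes to the outcome of `{x, y}`: the part of
the order that can be read off a single pair. -/
def WeaklyAbove (f : Finset X → H) (x y : X) : Prop := f {x} ≠ f {y} ∧ f {x, y} ≠ f {y}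

/-- `x` and `y` have different outcomes and both contribute to the outcome of `{x, y}`. -/
def Tied (f : Finset X → H) (x y : X) : Prop := WeaklyAbove f x y ∧ WeaklyAbove f y x

/-- The order revealed by `f`. A pair with equal outcomes reveals nothing, so its members are
compared through a third element `z` that is tied with the first one. -/
def Revealed (f : Finset X → H) (x y : X) : Prop :=
  WeaklyAbove f x y ∨ f {x} = f {y} ∧ ∃ z, Tied f x z ∧ WeaklyAbove f z y

theorem Tied.symm {x y : X} (h : Tied f x y) : Tied f y x := ⟨h.2, h.1⟩

theorem tied_iff {x y : X} :
    Tied f x y ↔ f {x} ≠ f {y} ∧ f {x, y} ≠ f {x} ∧ f {x, y} ≠ f {y} := by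
  unfold Tied WeaklyAbove
  rw [Finset.pair_comm y x]
  tauto

theorem weaklyAbove_or {x y : X} (h : f {x} ≠ f {y}) : WeaklyAbove f x y ∨ WeaklyAbove f y x := by
  by_contra! hc
  have h1 : f {x, y} = f {y} := by by_contra h1; exact hc.1 ⟨h, h1⟩
  have h2 : f {y, x} = f {x} := by by_contra h2; exact hc.2 ⟨h.symm, h2⟩
  rw [Finset.pair_comm] at h2
  exact h (h2.symm.trans h1)

theorem revealed_iff_of_ne {x y : X} (h : f {x} ≠ f {y}) :
    Revealed f x y ↔ WeaklyAbove f x y := by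
  simp [Revealed, h]

theorem Tied.revealed {x y : X} (h : Tied f x y) : Revealed f x y := Or.inl h.1

theorem Equivalent.tied {x y : X} (h : Equivalent (Revealed f) x y) (hne : f {x} ≠ f {y}) :
    Tied f x y :=
  ⟨(revealed_iff_of_ne hne).1 h.1, (revealed_iff_of_ne hne.symm).1 h.2⟩

theorem Tied.equivalent {x y : X} (h : Tied f x y) : Equivalent (Revealed f) x y :=
  ⟨h.revealed, h.symm.revealed⟩

theorem highest_pair_of_equivalent {r : X → X → Prop} (hr : IsWeakOrder r) {x y : X}
    (h : Equivalent r x y) : highest {x, y} r = {x, y} := by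
  ext a
  simp only [highest, Finset.mem_filter, Finset.mem_insert, Finset.mem_singleton,
    forall_eq_or_imp, forall_eq, and_iff_left_iff_imp]
  rintro (rfl | rfl)
  · exact ⟨hr.refl _, h.1⟩
  · exact ⟨h.2, hr.refl _⟩

theorem highest_pair_of_not {r : X → X → Prop} (hr : IsWeakOrder r) {x y : X} (h : r x y)
    (hyx : ¬ r y x) : highest {x, y} r = {x} := by
  ext a
  simp only [highest, Finset.mem_filter, Finset.mem_insert, Finset.mem_singleton,
    forall_eq_or_imp, forall_eq]
  constructor
  · rintro ⟨rfl | rfl, h1, h2⟩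
    · rfl
    · exact absurd h1 hyx
  · rintro rfl
    exact ⟨Or.inl rfl, hr.refl _, h⟩

end Revealed

section Order

variable [AddCommGroup H] [Module ℝ H] {f : Finset X → H}

theorem WeightedAveraging.pair (havg : WeightedAveraging f) (x y : X) :
    ∃ s : ℝ, 0 ≤ s ∧ s ≤ 1 ∧ f {x, y} = s • f {x} + (1 - s) • f {y} := by
  by_cases h : x = y
  · subst h
    exact ⟨1, by simp, by simp, by simp⟩
  · exact havg {x} {y} (by simp) (by simp) (by simpa using h)

theorem WeightedAveraging.triple (havg : WeightedAveraging f) {x y z : X} (hx : x ≠ z)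
    (hy : y ≠ z) :
    ∃ s : ℝ, 0 ≤ s ∧ s ≤ 1 ∧ f {x, y, z} = s • f {x, y} + (1 - s) • f {z} := by
  have := havg {x, y} {z} (by simp) (by simp) (by simp [hx.symm, hy.symm])
  rwa [show ({x, y} ∪ {z} : Finset X) = {x, y, z} by ext; simp] at this

/-- On a nondegenerate triangle `WeaklyAbove` is transitive: the three segments from a vertex to
the outcome of the opposite side all contain the outcome of the triple. -/
theorem WeaklyAbove.trans_of_not_collinear (havg : WeightedAveraging f) {x y z : X}
    (h : ¬ Collinear ℝ ({f {x}, f {y}, f {z}} : Set H))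
    (hxy : WeaklyAbove f x y) (hyz : WeaklyAbove f y z) : WeaklyAbove f x z := by
  have hxz : f {x} ≠ f {z} := by
    intro he
    rw [he, Set.insert_eq_of_mem (by simp)] at h
    exact h (collinear_pair ℝ _ _)
  refine ⟨hxz, fun hz => ?_⟩
  have nxy : x ≠ y := fun e => hxy.1 (by rw [e])
  have nyz : y ≠ z := fun e => hyz.1 (by rw [e])
  have nxz : x ≠ z := fun e => hxz (by rw [e])
  obtain ⟨s, -, -, hs⟩ := havg.pair x y
  obtain ⟨u, -, -, hu⟩ := havg.pair y z
  obtain ⟨t, -, -, ht⟩ := havg.triple nxz nyz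
  obtain ⟨v, -, -, hv⟩ := havg.triple nxy.symm nxz.symm
  obtain ⟨p, -, -, hp⟩ := havg.triple nxy nyz.symm
  rw [show ({y, z, x} : Finset X) = {x, y, z} by ext; simp; tauto] at hv
  rw [Finset.pair_comm z y, hz] at hp
  have hs0 : s ≠ 0 := by
    rintro rfl
    exact hxy.2 (by simpa using hs)
  have hu0 : u ≠ 0 := by
    rintro rfl
    exact hyz.2 (by simpa using hu)
  have h1 := coord_eq_of_not_collinear h
    (α := t * s) (β := t * (1 - s)) (γ := 1 - t) (α' := 0) (β' := 1 - p) (γ' := p) (by ring) (by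
      rw [hs] at ht
      linear_combination (norm := module) hp - ht)
  have h2 := coord_eq_of_not_collinear h
    (α := 1 - v) (β := v * u) (γ := v * (1 - u)) (α' := 0) (β' := 1 - p) (γ' := p) (by ring) (by
      rw [hu] at hv
      linear_combination (norm := module) hp - hv)
  have t0 : t = 0 := by simpa [hs0] using h1.1
  have v1 : v = 1 := by linarith [h2.1]
  apply hu0
  have e1 := h1.2.1
  have e2 := h2.2.1
  rw [t0] at e1
  rw [v1] at e2
  linarith

/-- The companions provided by strong richness cannot both lie on one line through `f {x}`. -/
theorem StronglyRich.exists_tied_off_line (hrich : StronglyRich f) (x : X) (d : H) :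
    ∃ z, Tied f x z ∧ ∀ α : ℝ, f {z} ≠ f {x} + α • d := by
  obtain ⟨y, z, hc, hy, hz⟩ := hrich x
  have nxy : f {x} ≠ f {y} := by
    intro he
    rw [he, Set.insert_eq_of_mem (by simp)] at hc
    exact hc (collinear_pair ℝ _ _)
  have nxz : f {x} ≠ f {z} := by
    intro he
    rw [he, Set.insert_eq_of_mem (by simp)] at hc
    exact hc (collinear_pair ℝ _ _)
  by_contra! hcon
  obtain ⟨α, hα⟩ := hcon y (tied_iff.2 ⟨nxy, hy⟩)
  obtain ⟨β, hβ⟩ := hcon z (tied_iff.2 ⟨nxz, hz⟩)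
  refine hc ((collinear_iff_of_mem (p₀ := f {x}) (by simp)).2 ⟨d, ?_⟩)
  simp only [Set.mem_insert_iff, Set.mem_singleton_iff, vadd_eq_add]
  rintro p (rfl | rfl | rfl)
  · exact ⟨0, by simp⟩
  · exact ⟨α, by rw [hα, add_comm]⟩
  · exact ⟨β, by rw [hβ, add_comm]⟩

/-- If `a ≠ f {x}`, then `x` is tied with some `z` for which `f {x}`, `a`, `f {z}` form a
nondegenerate triangle. -/
theorem StronglyRich.exists_tied_not_collinear (hrich : StronglyRich f) {x : X} {a : H}
    (ha : f {x} ≠ a) :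
    ∃ z, Tied f x z ∧ ¬ Collinear ℝ ({f {x}, a, f {z}} : Set H) := by
  obtain ⟨z, hz, hl⟩ := hrich.exists_tied_off_line x (a - f {x})
  exact ⟨z, hz, not_collinear_of_notMem_line ⟨0, by simp⟩ ⟨1, by simp⟩ ha hl⟩

theorem StronglyRich.exists_tied (hrich : StronglyRich f) (x : X) (a : H) :
    ∃ z, Tied f x z ∧ f {z} ≠ a := by
  obtain ⟨z, hz, hl⟩ := hrich.exists_tied_off_line x (a - f {x})
  exact ⟨z, hz, fun h => hl 1 (by rw [h]; simp)⟩

/-- The third element in the definition of `Revealed` is immaterial: any `w` tied with `x`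
serves, because some element tied with `x` avoids a given line through `f {x}`. -/
theorem WeaklyAbove.change_companion (hrich : StronglyRich f) (havg : WeightedAveraging f)
    {x y z w : X} (hxy : f {x} = f {y}) (hz : Tied f x z) (hzy : WeaklyAbove f z y)
    (hw : Tied f x w) : WeaklyAbove f w y := by
  have key : ∀ {z w : X}, Tied f x z → WeaklyAbove f z y → Tied f x w →
      ¬ Collinear ℝ ({f {w}, f {z}, f {x}} : Set H) → WeaklyAbove f w y := by
    intro z w hz hzy hw hc
    have h1 : WeaklyAbove f w z := by
      refine hw.2.trans_of_not_collinear havg ?_ hz.1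
      rwa [Set.pair_comm]
    exact h1.trans_of_not_collinear havg (hxy ▸ hc) hzy
  by_cases hc : Collinear ℝ ({f {w}, f {z}, f {x}} : Set H)
  · obtain ⟨d, hd⟩ := (collinear_iff_of_mem (p₀ := f {x}) (by simp)).1 hc
    obtain ⟨α, hα⟩ := hd (f {w}) (by simp)
    obtain ⟨β, hβ⟩ := hd (f {z}) (by simp)
    rw [vadd_eq_add, add_comm] at hα hβ
    obtain ⟨w', hw', hl⟩ := hrich.exists_tied_off_line x d
    have h1 : WeaklyAbove f w' y := by
      refine key hz hzy hw' ?_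
      exact not_collinear_rotate <| not_collinear_rotate <|
        not_collinear_of_notMem_line ⟨β, hβ⟩ ⟨0, by simp⟩ hz.2.1 hl
    refine key hw' h1 hw ?_
    rw [Set.pair_comm]
    exact not_collinear_of_notMem_line ⟨α, hα⟩ ⟨0, by simp⟩ hw.2.1 hl
  · exact key hz hzy hw hc

/-- An element `x'` that is tied with `x` and off the line through `f {x}` and `f {y}` is
related to `y` as `x` is. -/
theorem Revealed.weaklyAbove_of_tied (hrich : StronglyRich f) (havg : WeightedAveraging f)
    {x y x' : X} (h : Revealed f x y) (hx' : Tied f x x')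
    (hl : f {x} ≠ f {y} → ¬ Collinear ℝ ({f {x'}, f {x}, f {y}} : Set H)) :
    WeaklyAbove f x' y := by
  rcases h with h | ⟨he, z, hz, hzy⟩
  · exact hx'.2.trans_of_not_collinear havg (hl h.1) h
  · exact WeaklyAbove.change_companion hrich havg he hz hzy hx'

/-- If the three outcomes are on a line, `x` and, when `y` and `z` have the same outcome, also
`y` are replaced by elements tied with them for which the triangles are nondegenerate. -/
theorem Revealed.trans (hrich : StronglyRich f) (havg : WeightedAveraging f) {x y z : X}
    (hxy : Revealed f x y) (hyz : Revealed f y z) : Revealed f x z := by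
  by_cases hc : Collinear ℝ ({f {x}, f {y}, f {z}} : Set H)
  · obtain ⟨d, hd⟩ := (collinear_iff_of_mem (p₀ := f {x}) (by simp)).1 hc
    obtain ⟨α, hα⟩ := hd (f {y}) (by simp)
    obtain ⟨β, hβ⟩ := hd (f {z}) (by simp)
    rw [vadd_eq_add, add_comm] at hα hβ
    obtain ⟨x', hx', hl⟩ := hrich.exists_tied_off_line x d
    have hx'y : WeaklyAbove f x' y := hxy.weaklyAbove_of_tied hrich havg hx' fun hne =>
      not_collinear_rotate <| not_collinear_rotate <|
        not_collinear_of_notMem_line ⟨0, by simp⟩ ⟨α, hα⟩ hne hl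
    have hx'z : WeaklyAbove f x' z := by
      by_cases he : f {y} = f {z}
      · obtain ⟨y', hy', hnc⟩ := hrich.exists_tied_not_collinear hx'y.1.symm
        have h1 : WeaklyAbove f y' z := hyz.weaklyAbove_of_tied hrich havg hy' (absurd he)
        have h2 : WeaklyAbove f x' y' := by
          refine hx'y.trans_of_not_collinear havg ?_ hy'.1
          rwa [Set.insert_comm]
        refine h2.trans_of_not_collinear havg ?_ h1
        rw [← he]
        exact not_collinear_rotate hnc
      · refine hx'y.trans_of_not_collinear havg ?_ ((revealed_iff_of_ne he).1 hyz)
        exact not_collinear_rotate <| not_collinear_rotate <|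
          not_collinear_of_notMem_line ⟨α, hα⟩ ⟨β, hβ⟩ he hl
    by_cases he : f {x} = f {z}
    · exact Or.inr ⟨he, x', hx', hx'z⟩
    · refine Or.inl (hx'.1.trans_of_not_collinear havg ?_ hx'z)
      rw [Set.pair_comm]
      exact not_collinear_of_notMem_line ⟨0, by simp⟩ ⟨β, hβ⟩ he hl
  · have hne1 : f {x} ≠ f {y} := by
      intro he
      rw [he, Set.insert_eq_of_mem (by simp)] at hc
      exact hc (collinear_pair ℝ _ _)
    have hne2 : f {y} ≠ f {z} := by
      intro he
      rw [he, Set.pair_eq_singleton] at hc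
      exact hc (collinear_pair ℝ _ _)
    exact Or.inl (((revealed_iff_of_ne hne1).1 hxy).trans_of_not_collinear havg hc
      ((revealed_iff_of_ne hne2).1 hyz))

theorem revealed_total (hrich : StronglyRich f) (havg : WeightedAveraging f) (x y : X) :
    Revealed f x y ∨ Revealed f y x := by
  by_cases he : f {x} = f {y}
  · obtain ⟨z, hz, -⟩ := hrich.exists_tied x (f {x})
    rcases weaklyAbove_or (he ▸ hz.2.1 : f {z} ≠ f {y}) with h | h
    · exact Or.inl (Or.inr ⟨he, z, hz, h⟩)
    · obtain ⟨w, hw, hc⟩ := hrich.exists_tied_not_collinear h.1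
      have hwz : WeaklyAbove f w z :=
        hw.2.trans_of_not_collinear havg (not_collinear_rotate (not_collinear_rotate hc)) h
      refine Or.inr (Or.inr ⟨he.symm, w, hw, hwz.trans_of_not_collinear havg ?_ hz.2⟩)
      rw [he, Set.insert_comm]
      exact not_collinear_rotate hc
  · exact (weaklyAbove_or he).imp Or.inl Or.inl

theorem revealed_isWeakOrder (hrich : StronglyRich f) (havg : WeightedAveraging f) :
    IsWeakOrder (Revealed f) where
  refl x := by
    obtain ⟨z, hz, -⟩ := hrich.exists_tied x (f {x})
    exact Or.inr ⟨rfl, z, hz, hz.2⟩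
  trans _ _ _ h1 h2 := h1.trans hrich havg h2
  complete := revealed_total hrich havg

/-! ### Uniqueness of the order -/

theorem Represents.weaklyAbove_iff {r : X → X → Prop} {w : X → ℝ} (hr : IsWeakOrder r)
    (hw : ∀ x, 0 < w x) (hf : Represents f r w) {x y : X} (hne : f {x} ≠ f {y}) :
    WeaklyAbove f x y ↔ r x y := by
  have nxy : x ≠ y := fun e => hne (by rw [e])
  have hxy := hf {x, y} (by simp)
  constructor
  · intro h
    by_contra hn
    have hyx := (hr.complete x y).resolve_left hn
    rw [Finset.pair_comm, highest_pair_of_not hr hyx hn] at hxy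
    simp only [Finset.sum_singleton, div_self (hw y).ne', one_smul] at hxy
    exact h.2 (Finset.pair_comm x y ▸ hxy)
  · intro h
    refine ⟨hne, fun hc => ?_⟩
    by_cases hyx : r y x
    · rw [highest_pair_of_equivalent hr ⟨h, hyx⟩, hc, Finset.sum_pair nxy, Finset.sum_pair nxy] at hxy
      have hpos := add_pos (hw x) (hw y)
      have h0 : (w x / (w x + w y)) • (f {x} - f {y}) = 0 := by
        have h1 : w y / (w x + w y) = 1 - w x / (w x + w y) := by field_simp; ring
        rw [h1] at hxy
        linear_combination (norm := module) -hxy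
      rcases smul_eq_zero.1 h0 with h0 | h0
      · exact (div_pos (hw x) hpos).ne' h0
      · exact hne (sub_eq_zero.1 h0)
    · rw [highest_pair_of_not hr h hyx, hc] at hxy
      simp only [Finset.sum_singleton, div_self (hw x).ne', one_smul] at hxy
      exact hne hxy.symm

theorem Represents.eq_revealed (hrich : StronglyRich f) {r : X → X → Prop} {w : X → ℝ}
    (hr : IsWeakOrder r) (hw : ∀ x, 0 < w x) (hf : Represents f r w) : r = Revealed f := by
  ext x y
  by_cases he : f {x} = f {y}
  · obtain ⟨z, hz, -⟩ := hrich.exists_tied x (f {x})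
    have hxz := (hf.weaklyAbove_iff hr hw hz.1.1).1 hz.1
    have hzx := (hf.weaklyAbove_iff hr hw hz.2.1).1 hz.2
    constructor
    · intro h
      exact Or.inr ⟨he, z, hz, (hf.weaklyAbove_iff hr hw (he ▸ hz.2.1)).2 (hr.trans _ _ _ hzx h)⟩
    · rintro (h | ⟨-, u, hu, huy⟩)
      · exact absurd he h.1
      · exact hr.trans _ _ _ ((hf.weaklyAbove_iff hr hw hu.1.1).1 hu.1)
          ((hf.weaklyAbove_iff hr hw huy.1).1 huy)
  · rw [revealed_iff_of_ne he, hf.weaklyAbove_iff hr hw he]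

end Order

/-! ### Equivalence classes of the revealed order -/

section Classes

variable {f : Finset X → H}

theorem Equivalent.symm {r : X → X → Prop} {x y : X} (h : Equivalent r x y) : Equivalent r y x :=
  ⟨h.2, h.1⟩

theorem Equivalent.trans {r : X → X → Prop} (hr : IsWeakOrder r) {x y z : X}
    (h : Equivalent r x y) (h' : Equivalent r y z) : Equivalent r x z :=
  ⟨hr.trans _ _ _ h.1 h'.1, hr.trans _ _ _ h'.2 h.2⟩

/-- A representative of the class of elements equivalent to `x`, the same one for the whole
class. -/
noncomputable def classRep (f : Finset X → H) (x : X) : X :=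
  @Classical.epsilon X ⟨x⟩ (Equivalent (Revealed f) x)

theorem equivalent_classRep (hr : IsWeakOrder (Revealed f)) (x : X) :
    Equivalent (Revealed f) x (classRep f x) :=
  @Classical.epsilon_spec X (Equivalent (Revealed f) x) ⟨x, hr.refl x, hr.refl x⟩

theorem classRep_eq (hr : IsWeakOrder (Revealed f)) {x y : X}
    (h : Equivalent (Revealed f) x y) : classRep f x = classRep f y := by
  have : Equivalent (Revealed f) x = Equivalent (Revealed f) y := by
    ext z
    exact ⟨fun hz => h.symm.trans hr hz, fun hz => h.trans hr hz⟩
  simp only [classRep, this]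

end Classes

/-! ### Relative weights of tied elements -/

section Odds

variable [NormedAddCommGroup H] {f : Finset X → H}

/-- The weight of `x` relative to `y` that the outcome of `{x, y}` reveals; meaningful if `x` and
`y` are tied. Writing it as a ratio of distances makes its continuity evident. -/
noncomputable def odds (f : Finset X → H) (x y : X) : ℝ := ‖f {x, y} - f {y}‖ / ‖f {x, y} - f {x}‖

theorem Tied.odds_pos {x y : X} (h : Tied f x y) : 0 < odds f x y := by
  have hne := tied_iff.1 h
  exact div_pos (norm_pos_iff.2 (sub_ne_zero.2 hne.2.2)) (norm_pos_iff.2 (sub_ne_zero.2 hne.2.1))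

theorem Tied.odds_mul_swap {x y : X} (h : Tied f x y) : odds f x y * odds f y x = 1 := by
  have h1 := h.odds_pos
  rw [odds] at h1
  rw [odds, odds, Finset.pair_comm y x, ← inv_div ‖f {x, y} - f {y}‖, mul_inv_cancel₀ h1.ne']

/-- The weight of `x` relative to the representative of its class, computed through an element
tied with both since the two may have the same outcome. Such an element exists if `f` is
strongly rich and weighted averaging (`exists_tied_classRep`), so the value `1` is a mere default. -/
noncomputable def weight (f : Finset X → H) (x : X) : ℝ :=
  if h : ∃ b, Tied f x b ∧ Tied f b (classRep f x) then
    odds f x h.choose * odds f h.choose (classRep f x)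
  else 1

theorem weight_pos (x : X) : 0 < weight f x := by
  unfold weight
  split_ifs with h
  · exact mul_pos h.choose_spec.1.odds_pos h.choose_spec.2.odds_pos
  · exact one_pos

end Odds

section Weight

variable [NormedAddCommGroup H] [NormedSpace ℝ H] {f : Finset X → H}

theorem Tied.exists_odds_eq (havg : WeightedAveraging f) {x y : X} (h : Tied f x y) :
    ∃ s : ℝ, 0 < s ∧ s < 1 ∧ f {x, y} = s • f {x} + (1 - s) • f {y} ∧
      odds f x y = s / (1 - s) := by
  obtain ⟨s, hs0, hs1, hs⟩ := havg.pair x y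
  have hne := tied_iff.1 h
  have h0 : s ≠ 0 := by
    rintro rfl
    exact hne.2.2 (by simpa using hs)
  have h1 : s ≠ 1 := by
    rintro rfl
    exact hne.2.1 (by simpa using hs)
  refine ⟨s, hs0.lt_of_ne' h0, hs1.lt_of_ne h1, hs, ?_⟩
  have e1 : f {x, y} - f {y} = s • (f {x} - f {y}) := by
    rw [hs]
    module
  have e2 : f {x, y} - f {x} = -((1 - s) • (f {x} - f {y})) := by
    rw [hs]
    module
  have hn : ‖f {x} - f {y}‖ ≠ 0 := norm_ne_zero_iff.2 (sub_ne_zero.2 hne.1)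
  rw [odds, e1, e2, norm_neg, norm_smul, norm_smul, Real.norm_of_nonneg hs0,
    Real.norm_of_nonneg (by linarith), mul_div_mul_right _ _ hn]

/-- The relative weights on a nondegenerate triangle multiply, which is Ceva's theorem. -/
theorem odds_mul_of_not_collinear (havg : WeightedAveraging f) {x y z : X}
    (hc : ¬ Collinear ℝ ({f {x}, f {y}, f {z}} : Set H))
    (hxy : Tied f x y) (hyz : Tied f y z) (hzx : Tied f z x) :
    odds f x y * odds f y z = odds f x z := by
  have nxy : x ≠ y := fun e => hxy.1.1 (by rw [e])
  have nyz : y ≠ z := fun e => hyz.1.1 (by rw [e])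
  have nzx : z ≠ x := fun e => hzx.1.1 (by rw [e])
  obtain ⟨s, s0, s1, hs, os⟩ := hxy.exists_odds_eq havg
  obtain ⟨u, u0, u1, hu, ou⟩ := hyz.exists_odds_eq havg
  obtain ⟨p, p0, p1, hp, op⟩ := hzx.exists_odds_eq havg
  obtain ⟨t, -, -, ht⟩ := havg.triple nzx.symm nyz
  obtain ⟨v, -, -, hv⟩ := havg.triple nxy.symm nzx
  obtain ⟨q, -, -, hq⟩ := havg.triple nyz.symm nxy
  rw [show ({y, z, x} : Finset X) = {x, y, z} by ext; simp; tauto, hu] at hv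
  rw [show ({z, x, y} : Finset X) = {x, y, z} by ext; simp; tauto, hp] at hq
  rw [hs] at ht
  obtain ⟨a1, a2, a3⟩ := coord_eq_of_not_collinear hc
    (α := t * s) (β := t * (1 - s)) (γ := 1 - t)
    (α' := 1 - v) (β' := v * u) (γ' := v * (1 - u)) (by ring)
    (by linear_combination (norm := module) hv - ht)
  obtain ⟨b1, b2, b3⟩ := coord_eq_of_not_collinear hc
    (α := t * s) (β := t * (1 - s)) (γ := 1 - t)
    (α' := q * (1 - p)) (β' := 1 - q) (γ' := q * p) (by ring)
    (by linear_combination (norm := module) hq - ht)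
  -- `t`, `v` and `q` cannot vanish: if one of the three barycentric coordinates of the outcome of
  -- the triple is zero, then so are the other two.
  have t0 : t ≠ 0 := by
    rintro rfl
    have : v = 1 := by linarith
    rw [this] at a2
    linarith
  have v0 : v ≠ 0 := by
    rintro rfl
    have : t * (1 - s) = 0 := by linarith
    rcases mul_eq_zero.1 this with h | h
    · exact t0 h
    · linarith
  have q0 : q ≠ 0 := by
    rintro rfl
    have : t * s = 0 := by linarith
    rcases mul_eq_zero.1 this with h | h
    · exact t0 h
    · linarith
  have hceva : (1 - s) * (1 - u) * (1 - p) = s * u * p := by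
    refine mul_left_cancel₀ (mul_ne_zero (mul_ne_zero t0 v0) q0) ?_
    have c3 : v * (1 - u) = q * p := a3.symm.trans b3
    calc t * v * q * ((1 - s) * (1 - u) * (1 - p))
        = (t * (1 - s)) * (v * (1 - u)) * (q * (1 - p)) := by ring
      _ = (v * u) * (q * p) * (t * s) := by rw [a2, c3, b1]
      _ = t * v * q * (s * u * p) := by ring
  have hswap := hzx.symm.odds_mul_swap
  rw [op] at hswap
  have p1' : 1 - p ≠ 0 := by linarith
  have s1' : 1 - s ≠ 0 := by linarith
  have u1' : 1 - u ≠ 0 := by linarith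
  have hxz : odds f x z = (1 - p) / p := by
    field_simp at hswap ⊢
    linarith
  rw [os, ou, hxz]
  field_simp
  linarith

theorem Tied.trans (hrich : StronglyRich f) (havg : WeightedAveraging f) {x y z : X}
    (hxy : Tied f x y) (hyz : Tied f y z) (hne : f {x} ≠ f {z}) : Tied f x z :=
  Equivalent.tied ⟨hxy.revealed.trans hrich havg hyz.revealed,
    hyz.symm.revealed.trans hrich havg hxy.symm.revealed⟩ hne

/-- If the outcomes are on a line, the claim follows from three nondegenerate triangles that share
a vertex off the line. -/
theorem odds_mul (hrich : StronglyRich f) (havg : WeightedAveraging f) {x y z : X}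
    (hxy : Tied f x y) (hyz : Tied f y z) (hxz : Tied f x z) :
    odds f x y * odds f y z = odds f x z := by
  by_cases hc : Collinear ℝ ({f {x}, f {y}, f {z}} : Set H)
  · obtain ⟨d, hd⟩ := (collinear_iff_of_mem (p₀ := f {x}) (by simp)).1 hc
    obtain ⟨α, hα⟩ := hd (f {y}) (by simp)
    obtain ⟨β, hβ⟩ := hd (f {z}) (by simp)
    rw [vadd_eq_add, add_comm] at hα hβ
    obtain ⟨b, hb, hl⟩ := hrich.exists_tied_off_line x d
    have hby : Tied f b y := hb.symm.trans hrich havg hxy (by rw [hα]; exact hl α)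
    have hbz : Tied f b z := hb.symm.trans hrich havg hxz (by rw [hβ]; exact hl β)
    have e1 : odds f x b * odds f b y = odds f x y :=
      odds_mul_of_not_collinear havg (by
        rw [Set.pair_comm]
        exact not_collinear_of_notMem_line ⟨0, by simp⟩ ⟨α, hα⟩ hxy.1.1 hl) hb hby hxy.symm
    have e2 : odds f b y * odds f y z = odds f b z :=
      odds_mul_of_not_collinear havg
        (not_collinear_rotate <| not_collinear_rotate <|
          not_collinear_of_notMem_line ⟨α, hα⟩ ⟨β, hβ⟩ hyz.1.1 hl) hby hyz hbz.symm
    have e3 : odds f x b * odds f b z = odds f x z :=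
      odds_mul_of_not_collinear havg (by
        rw [Set.pair_comm]
        exact not_collinear_of_notMem_line ⟨0, by simp⟩ ⟨β, hβ⟩ hxz.1.1 hl) hb hbz hxz.symm
    rw [← e1, mul_assoc, e2, e3]
  · exact odds_mul_of_not_collinear havg hc hxy hyz hxz.symm

/-- The relative weight of `x` and `y` computed through an intermediate element does not depend on
that element. This makes sense also if `x` and `y` have the same outcome. -/
theorem odds_mul_odds_eq (hrich : StronglyRich f) (havg : WeightedAveraging f) {x y b c : X}
    (hxb : Tied f x b) (hby : Tied f b y) (hxc : Tied f x c) (hcy : Tied f c y) :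
    odds f x b * odds f b y = odds f x c * odds f c y := by
  by_cases he : f {x} = f {y}
  · have key : ∀ {b c : X}, Tied f x b → Tied f b y → Tied f x c → Tied f c y →
        f {b} ≠ f {c} → odds f x b * odds f b y = odds f x c * odds f c y := by
      intro b c hxb hby hxc hcy hne
      have hbc := hxb.symm.trans hrich havg hxc hne
      rw [← odds_mul hrich havg hxc hbc.symm hxb, mul_assoc, odds_mul hrich havg hbc.symm hby hcy]
    by_cases hbc : f {b} = f {c}
    · obtain ⟨e, he1, he2⟩ := hrich.exists_tied x (f {b})
      have hey : Tied f e y := he1.symm.trans hrich havg hxb he2 |>.trans hrich havg hby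
        (he ▸ he1.2.1)
      exact (key hxb hby he1 hey (Ne.symm he2)).trans (key he1 hey hxc hcy (hbc ▸ he2))
    · exact key hxb hby hxc hcy hbc
  · have hxy := hxb.trans hrich havg hby he
    rw [odds_mul hrich havg hxb hby hxy, odds_mul hrich havg hxc hcy hxy]

theorem weight_eq (hrich : StronglyRich f) (havg : WeightedAveraging f) {x b : X}
    (hxb : Tied f x b) (hb : Tied f b (classRep f x)) :
    weight f x = odds f x b * odds f b (classRep f x) := by
  have h : ∃ b, Tied f x b ∧ Tied f b (classRep f x) := ⟨b, hxb, hb⟩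
  rw [weight, dif_pos h]
  exact odds_mul_odds_eq hrich havg h.choose_spec.1 h.choose_spec.2 hxb hb

theorem exists_tied_classRep (hrich : StronglyRich f) (havg : WeightedAveraging f) (x : X) :
    ∃ b, Tied f x b ∧ Tied f b (classRep f x) := by
  have hr := revealed_isWeakOrder hrich havg
  obtain ⟨b, hb, hne⟩ := hrich.exists_tied x (f {classRep f x})
  exact ⟨b, hb, (hb.symm.equivalent.trans hr (equivalent_classRep hr x)).tied hne⟩

theorem weight_eq_odds_mul (hrich : StronglyRich f) (havg : WeightedAveraging f) {x y : X}
    (h : Tied f x y) : weight f x = odds f x y * weight f y := by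
  have hr := revealed_isWeakOrder hrich havg
  have hrep := classRep_eq hr h.equivalent
  have hex := equivalent_classRep hr x
  have hey := equivalent_classRep hr y
  obtain ⟨b, hb, hc⟩ := hrich.exists_tied_not_collinear h.1.1
  have hyb : Tied f y b := h.symm.trans hrich havg hb fun he => hc (by
    rw [he, Set.pair_eq_singleton]
    exact collinear_pair ℝ _ _)
  by_cases hbr : f {b} = f {classRep f x}
  · -- The representative is itself a third vertex, whose odds are the weights.
    have key : ∀ {z : X}, classRep f z = classRep f x → Tied f z (classRep f x) →
        weight f z = odds f z (classRep f x) := by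
      intro z hz hzt
      obtain ⟨c, hc1, hc2⟩ := exists_tied_classRep hrich havg z
      rw [weight_eq hrich havg hc1 hc2]
      rw [← hz] at hzt ⊢
      exact odds_mul hrich havg hc1 hc2 hzt
    have hx := hex.tied (hbr ▸ hb.1.1)
    have hy := (hrep ▸ hey).tied (hbr ▸ hyb.1.1)
    rw [key rfl hx, key hrep.symm hy, odds_mul hrich havg h hy hx]
  · have hbx : Tied f b (classRep f x) := (hb.symm.equivalent.trans hr hex).tied hbr
    rw [weight_eq hrich havg hb hbx, weight_eq hrich havg hyb (hrep ▸ hbx), ← hrep, ← mul_assoc,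
      odds_mul hrich havg h hyb hb]

end Weight

/-! ### Shares of the highest ranked elements -/

section Share

variable {r : X → X → Prop} {w : X → ℝ}

/-- The coefficient of `a` in the `w`-weighted average over the highest ranked elements of `A`. -/
noncomputable def share (r : X → X → Prop) (w : X → ℝ) (A : Finset X) (a : X) : ℝ :=
  if a ∈ highest A r then w a / ∑ y ∈ highest A r, w y else 0

theorem mem_highest {A : Finset X} {a : X} : a ∈ highest A r ↔ a ∈ A ∧ ∀ y ∈ A, r a y := by
  simp [highest]

theorem highest_nonempty (hr : IsWeakOrder r) {A : Finset X} (hA : A.Nonempty) :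
    (highest A r).Nonempty := by
  induction hA using Finset.Nonempty.cons_induction with
  | singleton a => exact ⟨a, by simp [mem_highest, hr.refl]⟩
  | cons a A ha hA ih =>
    obtain ⟨b, hb⟩ := ih
    rw [mem_highest] at hb
    rcases hr.complete a b with h | h
    · refine ⟨a, mem_highest.2 ⟨by simp, fun y hy => ?_⟩⟩
      rcases Finset.mem_cons.1 hy with rfl | hy
      · exact hr.refl _
      · exact hr.trans _ _ _ h (hb.2 y hy)
    · refine ⟨b, mem_highest.2 ⟨by simp [hb.1], fun y hy => ?_⟩⟩
      rcases Finset.mem_cons.1 hy with rfl | hy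
      · exact h
      · exact hb.2 y hy

theorem sum_highest_pos (hr : IsWeakOrder r) (hw : ∀ x, 0 < w x) {A : Finset X}
    (hA : A.Nonempty) : 0 < ∑ y ∈ highest A r, w y :=
  Finset.sum_pos (fun y _ => hw y) (highest_nonempty hr hA)

theorem share_nonneg (hw : ∀ x, 0 < w x) (A : Finset X) (a : X) : 0 ≤ share r w A a := by
  unfold share
  split_ifs
  · exact div_nonneg (hw a).le (Finset.sum_nonneg fun y _ => (hw y).le)
  · exact le_rfl

theorem share_pos (hr : IsWeakOrder r) (hw : ∀ x, 0 < w x) {A : Finset X} {a : X}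
    (ha : a ∈ highest A r) : 0 < share r w A a := by
  rw [share, if_pos ha]
  exact div_pos (hw a) (sum_highest_pos hr hw ⟨a, (mem_highest.1 ha).1⟩)

theorem sum_share_smul {M : Type*} [AddCommGroup M] [Module ℝ M] (A : Finset X) (g : X → M) :
    ∑ a ∈ A, share r w A a • g a =
      ∑ a ∈ highest A r, (w a / ∑ y ∈ highest A r, w y) • g a := by
  have hsub : highest A r ⊆ A := Finset.filter_subset _ _
  rw [← Finset.sum_subset hsub]
  · exact Finset.sum_congr rfl fun a ha => by rw [share, if_pos ha]
  · intro a _ ha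
    rw [share, if_neg ha, zero_smul]

theorem sum_share (hr : IsWeakOrder r) (hw : ∀ x, 0 < w x) {A : Finset X} (hA : A.Nonempty) :
    ∑ a ∈ A, share r w A a = 1 := by
  have h := sum_share_smul (r := r) (w := w) A fun _ => (1 : ℝ)
  simp only [smul_eq_mul, mul_one] at h
  rw [h, ← Finset.sum_div, div_self (sum_highest_pos hr hw hA).ne']

theorem share_lt_one (hr : IsWeakOrder r) (hw : ∀ x, 0 < w x) {A : Finset X} {a b : X}
    (ha : a ∈ A) (hb : b ∈ highest A r) (hba : b ≠ a) : share r w A a < 1 := by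
  rw [← sum_share hr hw ⟨a, ha⟩]
  exact Finset.single_lt_sum hba ha (mem_highest.1 hb).1 (share_pos hr hw hb)
    fun c _ _ => share_nonneg hw A c

/-- Luce's choice axiom for the shares: within a subset `B` of `A`, the shares with respect to `A`
are proportional to those with respect to `B`. -/
theorem share_eq_sum_mul (hr : IsWeakOrder r) (hw : ∀ x, 0 < w x) {A B : Finset X} (hBA : B ⊆ A)
    {b : X} (hb : b ∈ B) : share r w A b = (∑ a ∈ B, share r w A a) * share r w B b := by
  by_cases h : ∃ c ∈ B, c ∈ highest A r
  · obtain ⟨c, hcB, hcA⟩ := h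
    have hiff : ∀ a ∈ B, (a ∈ highest A r ↔ a ∈ highest B r) := by
      intro a ha
      rw [mem_highest, mem_highest]
      exact ⟨fun h => ⟨ha, fun y hy => h.2 y (hBA hy)⟩,
        fun h => ⟨hBA ha, fun y hy => hr.trans _ _ _ (h.2 c hcB) ((mem_highest.1 hcA).2 y hy)⟩⟩
    have hsum : ∑ a ∈ B, share r w A a =
        (∑ a ∈ highest B r, w a) / ∑ y ∈ highest A r, w y := by
      have hsub : highest B r ⊆ B := Finset.filter_subset _ _
      rw [Finset.sum_div, ← Finset.sum_subset hsub]
      · exact Finset.sum_congr rfl fun a ha => by rw [share, if_pos ((hiff a (hsub ha)).2 ha)]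
      · intro a haB ha
        rw [share, if_neg (fun h => ha ((hiff a haB).1 h))]
    rw [hsum]
    by_cases hbt : b ∈ highest B r
    · rw [share, if_pos ((hiff b hb).2 hbt), share, if_pos hbt]
      have h1 := (sum_highest_pos hr hw ⟨b, hb⟩).ne'
      have h2 := (sum_highest_pos hr hw ⟨b, hBA hb⟩).ne'
      field_simp
    · rw [share, if_neg (fun h => hbt ((hiff b hb).1 h)), share, if_neg hbt, mul_zero]
  · push Not at h
    rw [Finset.sum_eq_zero fun a ha => by rw [share, if_neg (h a ha)], zero_mul, share,
      if_neg (h b hb)]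

/-- The average of `v` over the highest ranked elements of `A`. -/
noncomputable def topMean [AddCommGroup H] [Module ℝ H] (r : X → X → Prop) (w : X → ℝ)
    (v : X → H) (A : Finset X) : H := ∑ a ∈ A, share r w A a • v a

variable [AddCommGroup H] [Module ℝ H] {v : X → H}

theorem topMean_singleton (hr : IsWeakOrder r) (hw : ∀ x, 0 < w x) (a : X) :
    topMean r w v {a} = v a := by
  have h := sum_share hr hw (Finset.singleton_nonempty a)
  rw [Finset.sum_singleton] at h
  rw [topMean, Finset.sum_singleton, h, one_smul]

theorem topMean_union (hr : IsWeakOrder r) (hw : ∀ x, 0 < w x) {B C : Finset X}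
    (hB : B.Nonempty) (hBC : Disjoint B C) :
    topMean r w v (B ∪ C) = (∑ b ∈ B, share r w (B ∪ C) b) • topMean r w v B +
      (1 - ∑ b ∈ B, share r w (B ∪ C) b) • topMean r w v C := by
  have h1 : ∑ c ∈ C, share r w (B ∪ C) c = 1 - ∑ b ∈ B, share r w (B ∪ C) b := by
    have := sum_share hr hw (hB.mono (Finset.subset_union_left (s₂ := C)))
    rw [Finset.sum_union hBC] at this
    linarith
  rw [← h1, topMean, Finset.sum_union hBC, topMean, topMean, Finset.smul_sum, Finset.smul_sum]
  congr 1 <;> refine Finset.sum_congr rfl fun a ha => ?_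
  · rw [share_eq_sum_mul hr hw Finset.subset_union_left ha, mul_smul]
  · rw [share_eq_sum_mul hr hw Finset.subset_union_right ha, mul_smul]

/-- Adding a single element `a` to a set moves the average towards `v a`. -/
theorem topMean_insert (hr : IsWeakOrder r) (hw : ∀ x, 0 < w x) {C : Finset X} {a : X}
    (ha : a ∉ C) :
    topMean r w v (insert a C) = share r w (insert a C) a • v a +
      (1 - share r w (insert a C) a) • topMean r w v C := by
  have h := topMean_union hr hw (v := v) (Finset.singleton_nonempty a)
    (Finset.disjoint_singleton_left.2 ha)
  rw [Finset.sum_singleton, topMean_singleton hr hw] at h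
  rwa [Finset.insert_eq]

theorem map_topMean_eq (hr : IsWeakOrder r) (hw : ∀ x, 0 < w x) {A : Finset X} (hA : A.Nonempty)
    (φ : H →ₗ[ℝ] ℝ) {c : ℝ} (h : ∀ a ∈ A, φ (v a) = c) : φ (topMean r w v A) = c := by
  rw [topMean, map_sum, Finset.sum_congr rfl fun a ha => by rw [map_smul, h a ha, smul_eq_mul],
    ← Finset.sum_mul, sum_share hr hw hA, one_mul]

/-- If removing any one element of `A` results in the same average, that is the average over `A`:
the average over `A` is the average over `a` of the points that `topMean_insert` locates. -/
theorem topMean_eq_of_erase (hr : IsWeakOrder r) (hw : ∀ x, 0 < w x) {A : Finset X}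
    (hA : 2 ≤ A.card) {p : H} (h : ∀ a ∈ A, topMean r w v (A.erase a) = p) :
    topMean r w v A = p := by
  have hne : A.Nonempty := Finset.card_pos.1 (by omega)
  have hstep : ∀ a ∈ A, topMean r w v A = share r w A a • v a + (1 - share r w A a) • p := by
    intro a ha
    have := topMean_insert hr hw (v := v) (Finset.notMem_erase a A)
    rwa [Finset.insert_erase ha, h a ha] at this
  have hsum := Finset.sum_congr (rfl : A = A) hstep
  rw [Finset.sum_const, Finset.sum_add_distrib, ← Finset.sum_smul, Finset.sum_sub_distrib,
    sum_share hr hw hne, Finset.sum_const, ← topMean, nsmul_eq_mul, mul_one,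
    ← Nat.cast_smul_eq_nsmul ℝ] at hsum
  have hc : ((A.card : ℝ) - 1) ≠ 0 := by
    have : (2 : ℝ) ≤ A.card := by exact_mod_cast hA
    linarith
  have h0 : ((A.card : ℝ) - 1) • (topMean r w v A - p) = 0 := by
    linear_combination (norm := module) hsum
  exact sub_eq_zero.1 ((smul_eq_zero.1 h0).resolve_left hc)

end Share

/-! ### The representation -/

/-- Two distinct points `g`, `g'` of a segment span a line that contains its endpoints. -/
theorem exists_eq_add_smul_of_segment [AddCommGroup H] [Module ℝ H] {u v g g' : H} {t s : ℝ}
    (hg : g = t • u + (1 - t) • v) (hg' : g' = s • u + (1 - s) • v) (hne : g ≠ g') :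
    (∃ α : ℝ, u = g + α • (g' - g)) ∧ ∃ β : ℝ, v = g + β • (g' - g) := by
  have hst : s - t ≠ 0 := fun h => hne (by rw [hg, hg', sub_eq_zero.1 h])
  have hd : g' - g = (s - t) • (u - v) := by
    rw [hg, hg']
    module
  refine ⟨⟨(1 - t) / (s - t), ?_⟩, ⟨-t / (s - t), ?_⟩⟩
  · rw [hd, smul_smul, div_mul_cancel₀ _ hst, hg]
    module
  · rw [hd, smul_smul, div_mul_cancel₀ _ hst, hg]
    module

/-- A linear functional that is constant on the line `p + ℝ d` and takes another value at a given
point off the line. -/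
theorem exists_linearMap_ne_of_notMem_line [AddCommGroup H] [Module ℝ H] {p d q : H}
    (hq : ∀ α : ℝ, q ≠ p + α • d) : ∃ φ : H →ₗ[ℝ] ℝ, φ d = 0 ∧ φ q ≠ φ p := by
  have hn : q - p ∉ Submodule.span ℝ {d} := by
    rw [Submodule.mem_span_singleton]
    rintro ⟨α, hα⟩
    exact hq α (by rw [hα]; abel)
  obtain ⟨φ, h1, h2⟩ := Submodule.exists_le_ker_of_notMem hn
  refine ⟨φ, h2 (Submodule.mem_span_singleton_self d), fun h => h1 ?_⟩
  rw [map_sub, h, sub_self]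

section Representation

variable [NormedAddCommGroup H] [NormedSpace ℝ H] {f : Finset X → H}

/-- The weighted average of the outcomes of the highest ranked elements of `A`, for the revealed
order and the revealed weights. -/
noncomputable def topAverage (f : Finset X → H) (A : Finset X) : H :=
  topMean (Revealed f) (weight f) (fun a => f {a}) A

theorem eq_topAverage_pair (hrich : StronglyRich f) (havg : WeightedAveraging f) (x y : X) :
    f {x, y} = topAverage f {x, y} := by
  have hr := revealed_isWeakOrder hrich havg
  have hw : ∀ x, 0 < weight f x := weight_pos
  by_cases he : f {x} = f {y}
  · obtain ⟨s, -, -, hs⟩ := havg.pair x y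
    rw [hs, topAverage, topMean, Finset.sum_congr rfl fun a ha => by
      rw [show f {a} = f {x} by
        rcases Finset.mem_insert.1 ha with rfl | ha
        · rfl
        · rw [Finset.mem_singleton.1 ha, he]], ← Finset.sum_smul,
      sum_share hr hw (Finset.insert_nonempty x {y}), he]
    module
  · have key : ∀ {x y : X}, Revealed f x y → ¬ Revealed f y x → f {x} ≠ f {y} →
        f {x, y} = topAverage f {x, y} := by
      intro x y h hn hne
      have h1 : f {y, x} = f {x} := by
        by_contra hc
        exact hn (Or.inl ⟨hne.symm, hc⟩)
      rw [topAverage, topMean, sum_share_smul, highest_pair_of_not hr h hn,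
        Finset.sum_singleton, Finset.sum_singleton, div_self (hw x).ne', one_smul,
        Finset.pair_comm, h1]
    by_cases hxy : Revealed f x y
    · by_cases hyx : Revealed f y x
      · have ht : Tied f x y := Equivalent.tied ⟨hxy, hyx⟩ he
        have nxy : x ≠ y := fun e => he (by rw [e])
        obtain ⟨s, s0, s1, hs, ho⟩ := ht.exists_odds_eq havg
        have hwt := weight_eq_odds_mul hrich havg ht
        have s1' : 1 - s ≠ 0 := by linarith
        have hy := (hw y).ne'
        rw [ho] at hwt
        have hsum : weight f x + weight f y = weight f y / (1 - s) := by
          rw [hwt]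
          field_simp
          ring
        rw [topAverage, topMean, sum_share_smul, highest_pair_of_equivalent hr ⟨hxy, hyx⟩,
          Finset.sum_pair nxy, Finset.sum_pair nxy, hsum, hs]
        congr 2
        · rw [hwt]
          field_simp
        · field_simp
      · exact key hxy hyx he
    · rw [Finset.pair_comm]
      exact key ((hr.complete x y).resolve_left hxy) hxy (Ne.symm he)

/-- The induction step for the representation. If `f A` differs from the average `topAverage f A`,
the two points span a line that contains all outcomes of elements of `A`. Adjoin an element `z`
off that line, tied with a highest ranked element of `A`. Unless all `A.erase a` have the same
average, the outcome of `insert z A` is determined by two different splittings of this set into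
smaller sets, and it determines `f A`. In the exceptional case the common average is that of `A`,
the outcome of a highest ranked element, and hence also `f A`. -/
theorem eq_topAverage_of_lt (hrich : StronglyRich f) (havg : WeightedAveraging f) {A : Finset X}
    (hA : 3 ≤ A.card)
    (ih : ∀ B : Finset X, B.Nonempty → B.card < A.card → f B = topAverage f B) :
    f A = topAverage f A := by
  have hr := revealed_isWeakOrder hrich havg
  have hw : ∀ x, 0 < weight f x := weight_pos
  have hne : A.Nonempty := Finset.card_pos.1 (by omega)
  have hcard : ∀ a ∈ A, (A.erase a).card = A.card - 1 := fun a ha => Finset.card_erase_of_mem ha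
  have hers : ∀ a ∈ A, (A.erase a).Nonempty := fun a ha =>
    Finset.card_pos.1 (by rw [hcard a ha]; omega)
  have ihe : ∀ a ∈ A, f (A.erase a) = topAverage f (A.erase a) := fun a ha =>
    ih _ (hers a ha) (by rw [hcard a ha]; omega)
  -- `f A` and the average both lie on the segment from `f {a}` to the outcome of the rest.
  have hf : ∀ a ∈ A, ∃ t : ℝ, f A = t • f {a} + (1 - t) • topAverage f (A.erase a) := by
    intro a ha
    obtain ⟨t, -, -, ht⟩ := havg {a} (A.erase a) (by simp) (hers a ha) (by simp)
    rw [← Finset.insert_eq, Finset.insert_erase ha, ihe a ha] at ht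
    exact ⟨t, ht⟩
  have hF : ∀ a ∈ A, topAverage f A = share (Revealed f) (weight f) A a • f {a} +
      (1 - share (Revealed f) (weight f) A a) • topAverage f (A.erase a) := by
    intro a ha
    have := topMean_insert hr hw (v := fun a => f {a}) (Finset.notMem_erase a A)
    rwa [Finset.insert_erase ha] at this
  obtain ⟨x, hx⟩ := highest_nonempty hr hne
  have hxA := (mem_highest.1 hx).1
  by_contra hcon
  have hline : ∀ a ∈ A, (∃ α : ℝ, f {a} = f A + α • (topAverage f A - f A)) ∧
      ∃ β : ℝ, topAverage f (A.erase a) = f A + β • (topAverage f A - f A) := by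
    intro a ha
    obtain ⟨t, ht⟩ := hf a ha
    exact exists_eq_add_smul_of_segment ht (hF a ha) hcon
  by_cases hall : ∀ a ∈ A, topAverage f (A.erase a) = topAverage f (A.erase x)
  · have hp : topAverage f A = topAverage f (A.erase x) :=
      topMean_eq_of_erase hr hw (by omega) hall
    have h1 := hF x hxA
    rw [← hp] at h1
    have h0 : share (Revealed f) (weight f) A x • (f {x} - topAverage f A) = 0 := by
      linear_combination (norm := module) -h1
    have hxe := sub_eq_zero.1 ((smul_eq_zero.1 h0).resolve_left (share_pos hr hw hx).ne')
    obtain ⟨t, ht⟩ := hf x hxA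
    rw [← hp, hxe] at ht
    exact hcon (by rw [ht]; module)
  · push Not at hall
    obtain ⟨b, hbA, hb⟩ := hall
    obtain ⟨z, hz, hzl⟩ := hrich.exists_tied_off_line x (topAverage f A - f A)
    obtain ⟨φ, hφd, hφz⟩ := exists_linearMap_ne_of_notMem_line hzl
    have hφ : ∀ {y : H}, (∃ α : ℝ, y = f A + α • (topAverage f A - f A)) → φ y = φ (f A) := by
      rintro y ⟨α, rfl⟩
      rw [map_add, map_smul, hφd, smul_zero, add_zero]
    have hφa : ∀ a ∈ A, φ (f {a}) = φ (f A) := fun a ha => hφ (hline a ha).1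
    rw [hφa x hxA] at hφz
    have hzA : z ∉ A := fun h => hφz (hφa z h)
    have hzins : z ∈ highest (insert z A) (Revealed f) := by
      refine mem_highest.2 ⟨by simp, fun y hy => ?_⟩
      rcases Finset.mem_insert.1 hy with rfl | hy
      · exact hr.refl _
      · exact hr.trans _ _ _ hz.symm.revealed ((mem_highest.1 hx).2 y hy)
    have hFz := topMean_insert hr hw (v := fun a => f {a}) hzA
    obtain ⟨t, -, -, hfz⟩ := havg {z} A (by simp) hne (by simpa using hzA)
    rw [← Finset.insert_eq] at hfz
    change topAverage f (insert z A) = _ • f {z} + _ • topAverage f A at hFz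
    have hφF : φ (topAverage f A) = φ (f A) := map_topMean_eq hr hw hne φ hφa
    by_cases hins : f (insert z A) = topAverage f (insert z A)
    · have hxins : x ∈ highest (insert z A) (Revealed f) := by
        refine mem_highest.2 ⟨by simp [hxA], fun y hy => ?_⟩
        rcases Finset.mem_insert.1 hy with rfl | hy
        · exact hz.revealed
        · exact (mem_highest.1 hx).2 y hy
      have hlt := share_lt_one hr hw (Finset.mem_insert_self z A) hxins
        (fun h => hzA (h ▸ hxA))
      rw [← hins, hfz] at hFz
      have hφe := congrArg φ hFz
      simp only [map_add, map_smul, smul_eq_mul, hφF] at hφe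
      have hts : t = share (Revealed f) (weight f) (insert z A) z := by
        refine mul_right_cancel₀ (sub_ne_zero.2 hφz) ?_
        linear_combination hφe
      rw [← hts] at hFz hlt
      have h0 : (1 - t) • (f A - topAverage f A) = 0 := by
        linear_combination (norm := module) hFz
      exact hcon (sub_eq_zero.1 ((smul_eq_zero.1 h0).resolve_left (by linarith)))
    · -- Otherwise all splittings into `A.erase a` and `{a, z}` happen on one line.
      have hsplit : ∀ a ∈ A,
          (∃ α : ℝ, topAverage f (A.erase a) =
            f (insert z A) + α • (topAverage f (insert z A) - f (insert z A))) ∧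
          ∃ β : ℝ, topAverage f {a, z} =
            f (insert z A) + β • (topAverage f (insert z A) - f (insert z A)) := by
        intro a ha
        have hu : A.erase a ∪ {a, z} = insert z A := by
          ext y
          simp only [Finset.mem_union, Finset.mem_erase, Finset.mem_insert, Finset.mem_singleton]
          by_cases hya : y = a
          · subst hya
            simp [ha]
          · simp [hya, or_comm]
        have hd : Disjoint (A.erase a) {a, z} := by
          simp [hzA]
        obtain ⟨u, -, -, hfu⟩ := havg _ _ (hers a ha) (Finset.insert_nonempty a {z}) hd
        have hFu := topMean_union hr hw (v := fun a => f {a}) (hers a ha) hd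
        rw [hu, ihe a ha, eq_topAverage_pair hrich havg] at hfu
        rw [hu] at hFu
        exact exists_eq_add_smul_of_segment hfu hFu hins
      obtain ⟨⟨α, hα⟩, β, hβ⟩ := hsplit x hxA
      obtain ⟨⟨α', hα'⟩, -⟩ := hsplit b hbA
      have e1 := hφ (hline x hxA).2
      have e2 := hφ (hline b hbA).2
      rw [hα, map_add, map_smul, smul_eq_mul] at e1
      rw [hα', map_add, map_smul, smul_eq_mul] at e2
      have hαα : α' - α ≠ 0 := fun h => hb (by rw [hα, hα', sub_eq_zero.1 h])
      have hD : φ (topAverage f (insert z A) - f (insert z A)) = 0 :=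
        (mul_eq_zero.1 (by linear_combination e2 - e1 :
          (α' - α) * φ (topAverage f (insert z A) - f (insert z A)) = 0)).resolve_left hαα
      have hxz : φ (topAverage f {x, z}) = φ (f A) := by
        rw [hβ, map_add, map_smul, hD]
        rw [hD] at e1
        simpa using e1
      have hzx : z ∈ highest {z, x} (Revealed f) := by
        rw [highest_pair_of_equivalent hr hz.symm.equivalent]
        simp
      have hFp := topMean_insert hr hw (v := fun a => f {a}) (C := {x}) (a := z)
        (by simpa using fun h : z = x => hzA (h ▸ hxA))
      rw [topMean_singleton hr hw] at hFp
      change topAverage f {z, x} = _ at hFp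
      rw [Finset.pair_comm, hFp, map_add, map_smul, map_smul, hφa x hxA] at hxz
      refine (mul_ne_zero (share_pos hr hw hzx).ne' (sub_ne_zero.2 hφz)) ?_
      simp only [smul_eq_mul] at hxz
      linear_combination hxz

theorem eq_topAverage (hrich : StronglyRich f) (havg : WeightedAveraging f) {A : Finset X}
    (hA : A.Nonempty) : f A = topAverage f A := by
  induction h : A.card using Nat.strong_induction_on generalizing A with
  | _ n ih =>
    subst h
    by_cases h3 : 3 ≤ A.card
    · exact eq_topAverage_of_lt hrich havg h3 fun B hB hlt => ih _ hlt hB rfl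
    · have h0 := Finset.card_pos.2 hA
      rcases (by omega : A.card = 1 ∨ A.card = 2) with h1 | h2
      · obtain ⟨a, rfl⟩ := Finset.card_eq_one.1 h1
        exact (topMean_singleton (v := fun a => f {a}) (revealed_isWeakOrder hrich havg)
          (weight_pos (f := f)) a).symm
      · obtain ⟨a, b, -, rfl⟩ := Finset.card_eq_two.1 h2
        exact eq_topAverage_pair hrich havg a b

theorem represents_revealed (hrich : StronglyRich f) (havg : WeightedAveraging f) :
    Represents f (Revealed f) (weight f) := fun A hA =>
  (eq_topAverage hrich havg hA).trans (sum_share_smul A _)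

end Representation

/-! ### Continuity -/

section Continuity

variable [NormedAddCommGroup H] [TopologicalSpace X] [FirstCountableTopology X] {f : Finset X → H}

theorem ContinuousRule.continuousAt_singleton (hcont : ContinuousRule f) (x : X) :
    ContinuousAt (fun y => f {y}) x :=
  tendsto_of_seq_tendsto fun u hu => by
    have := hcont ∅ x (by simp) u hu
    simp only [Finset.empty_union] at this
    exact this

theorem ContinuousRule.continuousAt_pair (hcont : ContinuousRule f) {x z : X} (h : x ≠ z) :
    ContinuousAt (fun y => f {y, z}) x :=
  tendsto_of_seq_tendsto fun u hu => by
    have := hcont {z} x (by simpa using h) u hu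
    simp only [Finset.union_comm {z}, ← Finset.insert_eq] at this
    exact this

theorem Tied.eventually (hcont : ContinuousRule f) {x z : X} (h : Tied f x z) :
    ∀ᶠ y in 𝓝 x, Tied f y z := by
  have h1 := hcont.continuousAt_singleton x
  have h2 := hcont.continuousAt_pair (z := z) fun e : x = z => h.1.1 (by rw [e])
  have hne := tied_iff.1 h
  filter_upwards [h1.eventually_ne hne.1, h2.eventually_ne hne.2.2,
    (h2.sub h1).eventually_ne (sub_ne_zero.2 hne.2.1)] with y e1 e2 e3
  exact tied_iff.2 ⟨e1, sub_ne_zero.1 e3, e2⟩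

theorem ContinuousRule.continuousAt_odds (hcont : ContinuousRule f) {x z : X} (h : Tied f x z) :
    ContinuousAt (fun y => odds f y z) x := by
  have h1 := hcont.continuousAt_singleton x
  have h2 := hcont.continuousAt_pair (z := z) fun e : x = z => h.1.1 (by rw [e])
  exact (h2.sub continuousAt_const).norm.div (h2.sub h1).norm
    (norm_ne_zero_iff.2 (sub_ne_zero.2 (tied_iff.1 h).2.1))

variable [NormedSpace ℝ H]

/-- A companion tied with `x` remains tied with the points near `x`. -/
theorem eventually_equivalent (hrich : StronglyRich f) (havg : WeightedAveraging f)
    (hcont : ContinuousRule f) (x : X) : ∀ᶠ y in 𝓝 x, Equivalent (Revealed f) y x := by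
  obtain ⟨z, hz, -⟩ := hrich.exists_tied x (f {x})
  filter_upwards [hz.eventually hcont] with y hy
  exact hy.equivalent.trans (revealed_isWeakOrder hrich havg) hz.symm.equivalent

theorem continuous_weight (hrich : StronglyRich f) (havg : WeightedAveraging f)
    (hcont : ContinuousRule f) : Continuous (weight f) := by
  refine continuous_iff_continuousAt.2 fun x => ?_
  obtain ⟨b, hb, -⟩ := hrich.exists_tied x (f {x})
  refine ((hcont.continuousAt_odds hb).mul_const (weight f b)).congr ?_
  filter_upwards [hb.eventually hcont] with y hy
  exact (weight_eq_odds_mul hrich havg hy).symm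

end Continuity

end Aggregation

theorem theorem3 {E H : Type*} [NormedAddCommGroup E] [NormedSpace ℝ E]
    [NormedAddCommGroup H] [NormedSpace ℝ H]
    (X : Set E) (f : Finset X → H)
    (hrich : Aggregation.StronglyRich f)
    (hcont : Aggregation.ContinuousRule f)
    (havg : Aggregation.WeightedAveraging f) :
    ∃ r : X → X → Prop, Aggregation.IsWeakOrder r ∧
      (∃ w : X → ℝ, (∀ x, 0 < w x) ∧ Continuous w ∧ Aggregation.Represents f r w) ∧
      (∀ (r' : X → X → Prop) (w' : X → ℝ), Aggregation.IsWeakOrder r' → (∀ x, 0 < w' x) →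
        Aggregation.Represents f r' w' → r' = r) ∧
      (∀ x : X, ∃ ε : ℝ, 0 < ε ∧ ∀ y : X, ‖(y : E) - (x : E)‖ < ε →
        Aggregation.Equivalent r y x) := by
  refine ⟨Aggregation.Revealed f, Aggregation.revealed_isWeakOrder hrich havg,
    ⟨Aggregation.weight f, Aggregation.weight_pos,
      Aggregation.continuous_weight hrich havg hcont,
      Aggregation.represents_revealed hrich havg⟩,
    fun r' w' hr' hw' hf' => hf'.eq_revealed hrich hr' hw', fun x => ?_⟩
  obtain ⟨ε, hε, h⟩ :=
    Metric.eventually_nhds_iff.1 (Aggregation.eventually_equivalent hrich havg hcont x)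
  refine ⟨ε, hε, fun y hy => h ?_⟩
  rwa [Subtype.dist_eq, dist_eq_norm]
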